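/- Let $\mathcal H$ be a separable complex Hilbert space (of finite or infinite dimension). Let $\Xi$ be the real vector space of self-adjoint trace-class operators on $\mathcal H$ with trace zero, with the Hilbert–Schmidt inner product $(\phi,\chi)_\Xi=\operatorname{Tr}[\phi\chi]$ and its norm. (If $\mathcal H$ is infinite-dimensional, $\Xi$ is an inner product space that is not complete; completeness is not used.) Fix a density operator $\rho_0$ on $\mathcal H$, and put $\Theta=\{\theta\in\Xi : \rho_0+\theta>0\}$, where $>0$ means $\langle x,(\rho_0+\theta)x\rangle>0$ for all $x\ne 0$, and $\rho(\theta)=\rho_0+\theta$ for $\theta\in\Theta$. *Measurement.* Let $M$ be a POVM on a measurable space $(\Omega,\mathfrak B)$, let $P_\theta(B)=\operatorname{Tr}[\rho(\theta)M(B)]$, and fix $\theta\in\Theta$. Assume the following at $\theta$. (i) For every $B\in\mathfrak B$ the function $\theta'\mapsto P_{\theta'}(B)$ on $\Theta$ is Fréchet differentiable at $\theta$, and there is a logarithmic gradient $\kappa:\Omega\to\Xi$, that is, $D_\theta P_\theta(B)[\phi]=\int_B(\kappa(x),\phi)_\Xi\,P_\theta(dx)$ for all $B\in\mathfrak B$ and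 $\phi\in\Xi$ (the integrand being $P_\theta$-integrable), with $\|\kappa\|_\Xi\in L^2(\Omega,P_\theta)$. (ii) The Fisher information operator $J=J^M_\theta=\mathbb E_\theta[\kappa\kappa^*]$ exists as a linear operator on $\Xi$: $(\phi,J\chi)_\Xi=\int_\Omega(\kappa(x),\phi)_\Xi(\kappa(x),\chi)_\Xi\,P_\theta(dx)$ for all $\phi,\chi\in\Xi$. (iii) The Moore–Penrose inverse $J^+$ exists, that is, a linear operator $J^+$ on $\Xi$ with $JJ^+J=J$, $J^+JJ^+=J^+$ and with $JJ^+$ and $J^+J$ symmetric. *Observable.* For a density operator $\rho$ and a (possibly unbounded) operator $A$, write $\rho A\in\mathcal T(\mathcal H)$ if $\rho A$, defined on $\operatorname{dom}A$, extends to a trace-class operator; if $A$ is densely defined, this extension is unique and $\operatorname{Tr}[\rho A]$ denotes its trace. Let $\mathcal O_\rho$ be the set of self-adjoint operators $A$ with $\rho A\in\mathcal T(\mathcal H)$. For such $A$ write $\langle A\rangle_{\theta'}=\operatorname{Tr}[\rho(\theta')A]$ where this is defined, and $\sigma^2_\theta(A)=\langle A^2\rangle_\theta-\langle A\rangle_\theta^2$.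 A gradient $\nabla_\theta\langle A\rangle_\theta$ is an element $G\in\Xi$ such that $\langle A\rangle_{\theta'}-\langle A\rangle_\theta-(G,\theta'-\theta)_\Xi=o(\|\theta'-\theta\|_\Xi)$ as $\theta'\to\theta$ within $\{\theta'\in\Theta: A\in\mathcal O_{\rho(\theta')}\}$. **Theorem.** Let $A\in\mathcal O_{\rho(\theta)}$. 1. If the gradient $\nabla_\theta\langle A\rangle_\theta$ exists and lies in $(\ker J^M_\theta)^\perp$, then $\rho(\theta)A^2\in\mathcal T(\mathcal H)$ (so the variance is finite) and $$\bigl(\nabla_\theta\langle A\rangle_\theta,\,(J^M_\theta)^+\nabla_\theta\langle A\rangle_\theta\bigr)_\Xi\ \ge\ \sigma^2_\theta(A).$$ 2. Consequently the measurement error $\varepsilon(A;\rho(\theta),M)\in(-\infty,+\infty]$, defined as $\bigl(\nabla_\theta\langle A\rangle_\theta,(J^M_\theta)^+\nabla_\theta\langle A\rangle_\theta\bigr)_\Xi-\sigma^2_\theta(A)$ if $\nabla_\theta\langle A\rangle_\theta$ exists and lies in $(\ker J^M_\theta)^\perp$, and as $+\infty$ otherwise, satisfies $\varepsilon(A;\rho(\theta),M)\ge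 0$. -/

import Mathlib

open scoped InnerProductSpace ComplexOrder

noncomputable section

namespace QuantumEstimation

open Filter Topology MeasureTheory

section TraceClass

variable {H : Type*} [NormedAddCommGroup H] [InnerProductSpace ℂ H]

/-- Trace-class (equivalently, on a Hilbert space, nuclear) operators: `T = ∑ |xₙ⟩⟨yₙ|`
with `∑ ‖xₙ‖ ‖yₙ‖ < ∞`. -/
def IsTraceClass (T : H →L[ℂ] H) : Prop :=
  ∃ x y : ℕ → H, Summable (fun n => ‖x n‖ * ‖y n‖) ∧
    ∀ v : H, HasSum (fun n => ⟪y n, v⟫_ℂ • x n) (T v)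

theorem IsTraceClass.zero : IsTraceClass (0 : H →L[ℂ] H) :=
  ⟨fun _ => 0, fun _ => 0, by simp, fun v => by simp⟩

theorem IsTraceClass.add {S T : H →L[ℂ] H} (hS : IsTraceClass S) (hT : IsTraceClass T) :
    IsTraceClass (S + T) := by
  obtain ⟨x, y, h, hx⟩ := hS
  obtain ⟨x', y', h', hx'⟩ := hT
  let e : ℕ ⊕ ℕ ≃ ℕ := Equiv.natSumNatEquivNat
  refine ⟨fun n => Sum.elim x x' (e.symm n), fun n => Sum.elim y y' (e.symm n), ?_, fun v => ?_⟩
  · refine (Equiv.summable_iff e.symm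
      (f := fun s => ‖Sum.elim x x' s‖ * ‖Sum.elim y y' s‖)).2 ?_
    exact (HasSum.sum (f := fun s => ‖Sum.elim x x' s‖ * ‖Sum.elim y y' s‖)
      (by simpa [Function.comp_def] using h.hasSum)
      (by simpa [Function.comp_def] using h'.hasSum)).summable
  · refine (Equiv.hasSum_iff e.symm
      (f := fun s => ⟪Sum.elim y y' s, v⟫_ℂ • Sum.elim x x' s)).2 ?_
    exact HasSum.sum (f := fun s => ⟪Sum.elim y y' s, v⟫_ℂ • Sum.elim x x' s)
      (by simpa [Function.comp_def] using hx v) (by simpa [Function.comp_def] using hx' v)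

theorem IsTraceClass.clm_comp {T : H →L[ℂ] H} (S : H →L[ℂ] H) (hT : IsTraceClass T) :
    IsTraceClass (S ∘L T) := by
  obtain ⟨x, y, h, hx⟩ := hT
  refine ⟨fun n => S (x n), y, ?_, fun v => ?_⟩
  · refine Summable.of_nonneg_of_le (fun n => by positivity) (fun n => ?_) (h.mul_left ‖S‖)
    calc ‖S (x n)‖ * ‖y n‖ ≤ (‖S‖ * ‖x n‖) * ‖y n‖ := by gcongr; exact S.le_opNorm _
      _ = _ := by ring
  · simpa using (hx v).mapL S

theorem IsTraceClass.smul {T : H →L[ℂ] H} (c : ℂ) (hT : IsTraceClass T) :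
    IsTraceClass (c • T) := by
  have := hT.clm_comp (c • ContinuousLinearMap.id ℂ H)
  have e : (c • ContinuousLinearMap.id ℂ H) ∘L T = c • T := by ext; simp
  rwa [e] at this

variable [CompleteSpace H]

variable (H) in
/-- The index set of a chosen orthonormal basis of `H`. -/
def basisSet : Set H := (exists_hilbertBasis ℂ H).choose

variable (H) in
/-- A chosen orthonormal basis of `H`. -/
def basis : HilbertBasis (basisSet H) ℂ H := (exists_hilbertBasis ℂ H).choose_spec.choose

/-- The trace `∑ᵢ ⟨eᵢ, T eᵢ⟩` (for trace-class `T` the sum converges absolutely and does not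
depend on the orthonormal basis). -/
def trace (T : H →L[ℂ] H) : ℂ := ∑' i, ⟪basis H i, T (basis H i)⟫_ℂ

theorem sum_norm_inner_le (x y : H) (s : Finset (basisSet H)) :
    ∑ i ∈ s, ‖⟪y, basis H i⟫_ℂ * ⟪basis H i, x⟫_ℂ‖ ≤ ‖x‖ * ‖y‖ := by
  have o := (basis H).orthonormal
  have h1 := Finset.sum_mul_sq_le_sq_mul_sq s (fun i => ‖⟪basis H i, x⟫_ℂ‖)
    (fun i => ‖⟪basis H i, y⟫_ℂ‖)
  have h2 := o.sum_inner_products_le (s := s) x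
  have h3 := o.sum_inner_products_le (s := s) y
  have h4 : ∑ i ∈ s, ‖⟪y, basis H i⟫_ℂ * ⟪basis H i, x⟫_ℂ‖
      = ∑ i ∈ s, ‖⟪basis H i, x⟫_ℂ‖ * ‖⟪basis H i, y⟫_ℂ‖ := by
    refine Finset.sum_congr rfl fun i _ => ?_
    rw [norm_mul, mul_comm, norm_inner_symm y]
  rw [h4]
  refine abs_le_of_sq_le_sq' (h1.trans ?_) (by positivity) |>.2
  rw [mul_pow]
  exact mul_le_mul h2 h3 (Finset.sum_nonneg fun _ _ => by positivity) (by positivity)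

theorem hasSum_diag {T : H →L[ℂ] H} {x y : ℕ → H} (h : Summable (fun n => ‖x n‖ * ‖y n‖))
    (hT : ∀ v : H, HasSum (fun n => ⟪y n, v⟫_ℂ • x n) (T v)) :
    HasSum (fun i => ⟪basis H i, T (basis H i)⟫_ℂ) (∑' n, ⟪y n, x n⟫_ℂ) := by
  let F : ℕ × basisSet H → ℂ := fun p => ⟪y p.1, basis H p.2⟫_ℂ * ⟪basis H p.2, x p.1⟫_ℂ
  have hF : Summable F := by
    refine Summable.of_norm ?_
    refine (summable_prod_of_nonneg (fun p => norm_nonneg _)).2 ⟨fun n => ?_, ?_⟩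
    · exact summable_of_sum_le (fun _ => norm_nonneg _) (sum_norm_inner_le (x n) (y n))
    · exact Summable.of_nonneg_of_le (fun n => tsum_nonneg fun _ => norm_nonneg _)
        (fun n => Real.tsum_le_of_sum_le (fun _ => norm_nonneg _)
          (sum_norm_inner_le (x n) (y n))) h
  have h1 : HasSum (fun n => ⟪y n, x n⟫_ℂ) (∑' p, F p) :=
    hF.hasSum.prod_fiberwise fun n => (basis H).hasSum_inner_mul_inner (y n) (x n)
  have h2 : HasSum (fun p : basisSet H × ℕ => F p.swap) (∑' p, F p) :=
    (Equiv.hasSum_iff (Equiv.prodComm _ _)).2 hF.hasSum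
  rw [h1.tsum_eq]
  refine h2.prod_fiberwise fun i => ?_
  have := (hT (basis H i)).mapL (innerSL ℂ (basis H i))
  simpa [F, inner_smul_right] using this

theorem IsTraceClass.summable_diag {T : H →L[ℂ] H} (hT : IsTraceClass T) :
    Summable (fun i => ⟪basis H i, T (basis H i)⟫_ℂ) := by
  obtain ⟨x, y, h, hx⟩ := hT
  exact (hasSum_diag h hx).summable

theorem trace_add {S T : H →L[ℂ] H} (hS : IsTraceClass S) (hT : IsTraceClass T) :
    trace (S + T) = trace S + trace T := by
  simp only [trace, add_apply, inner_add_right]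
  exact hS.summable_diag.tsum_add hT.summable_diag

theorem trace_smul (c : ℂ) (T : H →L[ℂ] H) : trace (c • T) = c * trace T := by
  simp only [trace, smul_apply, inner_smul_right]
  exact tsum_mul_left

theorem trace_comp_eq {T : H →L[ℂ] H} {x y : ℕ → H} (h : Summable (fun n => ‖x n‖ * ‖y n‖))
    (hT : ∀ v : H, HasSum (fun n => ⟪y n, v⟫_ℂ • x n) (T v)) (S : H →L[ℂ] H) :
    trace (T ∘L S) = ∑' n, ⟪y n, S (x n)⟫_ℂ := by
  have h' : Summable (fun n => ‖x n‖ * ‖S.adjoint (y n)‖) := by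
    refine Summable.of_nonneg_of_le (fun n => by positivity) (fun n => ?_)
      (h.mul_left ‖S.adjoint‖)
    calc ‖x n‖ * ‖S.adjoint (y n)‖ ≤ ‖x n‖ * (‖S.adjoint‖ * ‖y n‖) := by
          gcongr; exact ContinuousLinearMap.le_opNorm _ _
      _ = _ := by ring
  have := hasSum_diag (T := T ∘L S) (x := x) (y := fun n => S.adjoint (y n)) h' fun v => by
    simpa [ContinuousLinearMap.adjoint_inner_left] using hT (S v)
  simpa [trace, ContinuousLinearMap.adjoint_inner_left] using this.tsum_eq

end TraceClass

section States

variable (H : Type*) [NormedAddCommGroup H] [InnerProductSpace ℂ H] [CompleteSpace H]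

/-- Density operators on `H`. -/
structure DensityOperator where
  op : H →L[ℂ] H
  pos : op.IsPositive
  traceClass : IsTraceClass op
  trace_eq_one : trace op = 1

/-- The self-adjoint trace-class operators of trace zero, as a real vector space. -/
def tangentSubmodule : Submodule ℝ (H →L[ℂ] H) where
  carrier := {φ | IsSelfAdjoint φ ∧ IsTraceClass φ ∧ trace φ = 0}
  zero_mem' := by
    refine ⟨?_, IsTraceClass.zero, ?_⟩
    · exact star_zero _
    · simp [trace]
  add_mem' := by
    rintro a b ⟨ha, ha', ha''⟩ ⟨hb, hb', hb''⟩
    refine ⟨?_, ha'.add hb', ?_⟩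
    · exact IsSelfAdjoint.add ha hb
    · rw [trace_add ha' hb', ha'', hb'', add_zero]
  smul_mem' := by
    rintro c a ⟨ha, ha', ha''⟩
    have e : c • a = (c : ℂ) • a := (Complex.coe_smul c a).symm
    rw [e]
    refine ⟨?_, ha'.smul c, ?_⟩
    · have : star ((c : ℂ) • a) = (c : ℂ) • a := by
        rw [star_smul, IsSelfAdjoint.star_eq ha, Complex.star_def, Complex.conj_ofReal]
      exact this
    · rw [trace_smul, ha'', mul_zero]

/-- The parameter space `Ξ`: self-adjoint trace-class operators of trace zero. It carries the
Hilbert-Schmidt inner product (defined below), not the operator norm. -/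
def Xi : Type _ := tangentSubmodule H

instance : AddCommGroup (Xi H) := inferInstanceAs (AddCommGroup (tangentSubmodule H))

instance : Module ℝ (Xi H) := inferInstanceAs (Module ℝ (tangentSubmodule H))

variable {H}

/-- The operator underlying an element of `Ξ`. -/
def Xi.op (φ : Xi H) : H →L[ℂ] H := Subtype.val (p := fun T => T ∈ tangentSubmodule H) φ

theorem Xi.isSelfAdjoint (φ : Xi H) : IsSelfAdjoint φ.op := φ.2.1

theorem Xi.isTraceClass (φ : Xi H) : IsTraceClass φ.op := φ.2.2.1

theorem Xi.trace_eq_zero (φ : Xi H) : trace φ.op = 0 := φ.2.2.2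

theorem Xi.op_add (φ χ : Xi H) : (φ + χ).op = φ.op + χ.op := rfl

theorem Xi.op_smul (c : ℝ) (φ : Xi H) : (c • φ).op = (c : ℂ) • φ.op :=
  (Complex.coe_smul c φ.op).symm

theorem Xi.ext {φ χ : Xi H} (h : φ.op = χ.op) : φ = χ := Subtype.ext h

theorem Xi.inner_diag (φ χ : Xi H) (i : basisSet H) :
    ⟪basis H i, (φ.op ∘L χ.op) (basis H i)⟫_ℂ = ⟪φ.op (basis H i), χ.op (basis H i)⟫_ℂ := by
  have h := φ.isSelfAdjoint.adjoint_eq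
  conv_rhs => rw [← h]
  rw [ContinuousLinearMap.adjoint_inner_left]
  rfl

/-- The Hilbert-Schmidt inner product `Tr[φ* χ] = Tr[φ χ]` on `Ξ`. -/
@[reducible]
def Xi.core : InnerProductSpace.Core ℝ (Xi H) where
  inner φ χ := (trace (φ.op ∘L χ.op)).re
  conj_inner_symm φ χ := by
    simp only [trace, conj_trivial]
    rw [← Complex.hasSum_re (χ.isTraceClass.clm_comp φ.op).summable_diag.hasSum |>.tsum_eq,
      ← Complex.hasSum_re (φ.isTraceClass.clm_comp χ.op).summable_diag.hasSum |>.tsum_eq]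
    refine tsum_congr fun i => ?_
    rw [Xi.inner_diag, Xi.inner_diag, ← inner_conj_symm, Complex.conj_re]
  re_inner_nonneg φ := by
    simp only [trace, RCLike.re_to_real]
    rw [← Complex.hasSum_re (φ.isTraceClass.clm_comp φ.op).summable_diag.hasSum |>.tsum_eq]
    refine tsum_nonneg fun i => ?_
    rw [Xi.inner_diag]
    exact inner_self_nonneg (𝕜 := ℂ)
  add_left φ χ ψ := by
    rw [Xi.op_add, ContinuousLinearMap.add_comp,
      trace_add (ψ.isTraceClass.clm_comp φ.op) (ψ.isTraceClass.clm_comp χ.op), Complex.add_re]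
  smul_left φ χ c := by
    rw [Xi.op_smul, ContinuousLinearMap.smul_comp, trace_smul]
    simp
  definite φ h := by
    have hs := Complex.hasSum_re (φ.isTraceClass.clm_comp φ.op).summable_diag.hasSum
    have hs' : HasSum (fun i => ‖φ.op (basis H i)‖ ^ 2) 0 := by
      have : (trace (φ.op ∘L φ.op)).re = 0 := h
      rw [trace] at this
      rw [this] at hs
      refine hs.congr_fun ?_
      intro i
      rw [Xi.inner_diag]
      exact (inner_self_eq_norm_sq (𝕜 := ℂ) _).symm
    have hz : ∀ i, φ.op (basis H i) = 0 := fun i => by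
      have := congrFun ((hasSum_zero_iff_of_nonneg fun i => by positivity).1 hs') i
      simpa using this
    refine Xi.ext ?_
    refine ContinuousLinearMap.ext_on (s := Set.range (basis H)) ?_ ?_
    · rw [dense_iff_closure_eq, ← Submodule.topologicalClosure_coe, (basis H).dense_span]; rfl
    · rintro _ ⟨i, rfl⟩
      rw [hz i]; rfl

instance : NormedAddCommGroup (Xi H) := (Xi.core (H := H)).toNormedAddCommGroup

instance : InnerProductSpace ℝ (Xi H) := InnerProductSpace.ofCore Xi.core.toCore

theorem Xi.inner_def (φ χ : Xi H) : ⟪φ, χ⟫_ℝ = (trace (φ.op ∘L χ.op)).re := rfl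

/-- `Θ = {θ ∈ Ξ | ρ₀ + θ > 0}`, where `> 0` is strict positivity. -/
def Theta (ρ₀ : DensityOperator H) : Set (Xi H) :=
  {θ | ∀ x : H, x ≠ 0 → 0 < (⟪(ρ₀.op + θ.op) x, x⟫_ℂ).re}

/-- The state `ρ(θ) = ρ₀ + θ`. -/
def state (ρ₀ : DensityOperator H) (θ : Theta ρ₀) : DensityOperator H where
  op := ρ₀.op + θ.1.op
  pos := by
    refine ContinuousLinearMap.isPositive_def'.2
      ⟨ρ₀.pos.isSelfAdjoint.add θ.1.isSelfAdjoint, fun x => ?_⟩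
    rcases eq_or_ne x 0 with rfl | hx
    · simp [ContinuousLinearMap.reApplyInnerSelf]
    · exact (θ.2 x hx).le
  traceClass := ρ₀.traceClass.add θ.1.isTraceClass
  trace_eq_one := by
    rw [trace_add ρ₀.traceClass θ.1.isTraceClass, ρ₀.trace_eq_one, θ.1.trace_eq_zero, add_zero]

end States

section Measurements

variable {H : Type*} [NormedAddCommGroup H] [InnerProductSpace ℂ H]
variable {Ω : Type*} [MeasurableSpace Ω]

/-- Positive operator-valued measures on `Ω` (countable additivity in the weak operator
topology). -/
structure POVM (H : Type*) [NormedAddCommGroup H] [InnerProductSpace ℂ H]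
    (Ω : Type*) [MeasurableSpace Ω] where
  eff : Set Ω → H →L[ℂ] H
  pos : ∀ B, MeasurableSet B → (eff B).IsPositive
  univ : eff Set.univ = ContinuousLinearMap.id ℂ H
  iUnion : ∀ B : ℕ → Set Ω, (∀ n, MeasurableSet (B n)) → Pairwise (Function.onFun Disjoint B) →
    ∀ x y : H, HasSum (fun n => ⟪x, eff (B n) y⟫_ℂ) ⟪x, eff (⋃ n, B n) y⟫_ℂ

theorem POVM.empty (M : POVM H Ω) : M.eff ∅ = 0 := by
  ext y
  refine ext_inner_left ℂ fun x => ?_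
  have h := M.iUnion (fun _ => ∅) (fun _ => MeasurableSet.empty) (fun _ _ _ => by
    simp [Function.onFun]) x y
  have h0 : ⟪x, M.eff ∅ y⟫_ℂ = 0 := by
    have := h.summable.tendsto_atTop_zero
    exact tendsto_nhds_unique tendsto_const_nhds this
  simpa using h0

variable [CompleteSpace H]

theorem re_trace_comp_nonneg {ρ S : H →L[ℂ] H} (hρ : ρ.IsPositive) (ht : IsTraceClass ρ)
    (hS : S.IsPositive) : 0 ≤ (trace (ρ ∘L S)).re := by
  have hS0 : 0 ≤ S := (ContinuousLinearMap.nonneg_iff_isPositive S).2 hS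
  set R := CFC.sqrt S with hR
  have hRR : R * R = S := CFC.sqrt_mul_sqrt_self S hS0
  have hRsa : IsSelfAdjoint R := (CFC.sqrt_nonneg S).isSelfAdjoint
  have hR' : ∀ u v, ⟪R u, v⟫_ℂ = ⟪u, R v⟫_ℂ := fun u v => by
    conv_lhs => rw [← hRsa.adjoint_eq]
    rw [ContinuousLinearMap.adjoint_inner_left]
  obtain ⟨x, y, h, hx⟩ := ht
  have h' : Summable (fun n => ‖R (x n)‖ * ‖R (y n)‖) := by
    refine Summable.of_nonneg_of_le (fun n => by positivity) (fun n => ?_)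
      (h.mul_left (‖R‖ * ‖R‖))
    calc ‖R (x n)‖ * ‖R (y n)‖ ≤ (‖R‖ * ‖x n‖) * (‖R‖ * ‖y n‖) := by
          gcongr <;> exact R.le_opNorm _
      _ = _ := by ring
  have hsum := hasSum_diag (T := R ∘L ρ ∘L R) h' fun v => by
    simpa [hR'] using (hx (R v)).mapL R
  have hkey : trace (ρ ∘L S) = ∑' n, ⟪R (y n), R (x n)⟫_ℂ := by
    rw [trace_comp_eq h hx]
    refine tsum_congr fun n => ?_
    rw [hR', ← hRR]; rfl
  rw [hkey]
  refine (Complex.hasSum_re hsum).nonneg fun i => ?_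
  have : ⟪basis H i, (R ∘L ρ ∘L R) (basis H i)⟫_ℂ = ⟪R (basis H i), ρ (R (basis H i))⟫_ℂ := by
    rw [hR']; rfl
  rw [this]
  exact hρ.re_inner_nonneg_right _

theorem POVM.hasSum_trace (M : POVM H Ω) {ρ : H →L[ℂ] H} (ht : IsTraceClass ρ)
    (B : ℕ → Set Ω) (hB : ∀ n, MeasurableSet (B n))
    (hd : Pairwise (Function.onFun Disjoint B)) :
    HasSum (fun n => (trace (ρ ∘L M.eff (B n))).re) (trace (ρ ∘L M.eff (⋃ n, B n))).re := by
  obtain ⟨x, y, h, hx⟩ := ht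
  have hle : ∀ s : Finset ℕ, ∑ k ∈ s, M.eff (B k) ≤ M.eff (⋃ n, B n) := fun s => by
    rw [ContinuousLinearMap.le_def]
    have hpos : ∀ v, ⟪v, (∑ k ∈ s, M.eff (B k)) v⟫_ℂ ≤ ⟪v, M.eff (⋃ n, B n) v⟫_ℂ := fun v => by
      rw [sum_apply, inner_sum]
      exact sum_le_hasSum s (fun k _ => (M.pos _ (hB k)).inner_nonneg_right v)
        (M.iUnion B hB hd v v)
    refine (ContinuousLinearMap.isPositive_iff' _).2 ⟨?_, fun v => ?_⟩
    · exact (M.pos _ (MeasurableSet.iUnion hB)).isSelfAdjoint.sub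
        (isSelfAdjoint_sum _ fun k _ => (M.pos _ (hB k)).isSelfAdjoint)
    · have h1 := (Complex.le_def.1 (hpos v))
      have h2 : 0 ≤ ⟪v, (M.eff (⋃ n, B n) - ∑ k ∈ s, M.eff (B k)) v⟫_ℂ := by
        rw [sub_apply, inner_sub_right]
        exact sub_nonneg.2 (hpos v)
      rw [← inner_conj_symm]
      exact star_nonneg_iff.2 h2
  have hnorm : ∀ s : Finset ℕ, ‖∑ k ∈ s, M.eff (B k)‖ ≤ ‖M.eff (⋃ n, B n)‖ := fun s =>
    CStarAlgebra.norm_le_norm_of_nonneg_of_le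
      (Finset.sum_nonneg fun k _ =>
        (ContinuousLinearMap.nonneg_iff_isPositive _).2 (M.pos _ (hB k))) (hle s)
  have hb : ∀ (S : H →L[ℂ] H) (n : ℕ), ‖⟪y n, S (x n)⟫_ℂ‖ ≤ ‖S‖ * (‖x n‖ * ‖y n‖) := fun S n =>
    calc ‖⟪y n, S (x n)⟫_ℂ‖ ≤ ‖y n‖ * ‖S (x n)‖ := norm_inner_le_norm _ _
      _ ≤ ‖y n‖ * (‖S‖ * ‖x n‖) := by gcongr; exact S.le_opNorm _
      _ = _ := by ring
  have hsm : ∀ S : H →L[ℂ] H, Summable fun n => ⟪y n, S (x n)⟫_ℂ := fun S =>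
    Summable.of_norm_bounded (h.mul_left ‖S‖) (hb S)
  have hC : HasSum (fun k => trace (ρ ∘L M.eff (B k))) (trace (ρ ∘L M.eff (⋃ n, B n))) := by
    simp only [trace_comp_eq h hx]
    have hlim := tendsto_tsum_of_dominated_convergence (𝓕 := (atTop : Filter (Finset ℕ)))
      (f := fun s n => ∑ k ∈ s, ⟪y n, M.eff (B k) (x n)⟫_ℂ)
      (g := fun n => ⟪y n, M.eff (⋃ n, B n) (x n)⟫_ℂ)
      (h.mul_left ‖M.eff (⋃ n, B n)‖) (fun n => M.iUnion B hB hd (y n) (x n))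
      (Eventually.of_forall fun s n => by
        have e := hb (∑ k ∈ s, M.eff (B k)) n
        rw [sum_apply, inner_sum] at e
        exact e.trans (mul_le_mul_of_nonneg_right (hnorm s) (by positivity)))
    refine hlim.congr fun s => ?_
    exact Summable.tsum_finsetSum fun k _ => hsm _
  exact Complex.hasSum_re hC

/-- The outcome distribution `P(B) = Tr[ρ M(B)]`. -/
def POVM.law (M : POVM H Ω) (ρ : DensityOperator H) : Measure Ω :=
  Measure.ofMeasurable (fun B _ => ENNReal.ofReal (trace (ρ.op ∘L M.eff B)).re)
    (by simp [M.empty, trace])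
    (by
      intro B hB hd
      have hs := M.hasSum_trace ρ.traceClass B hB hd
      rw [← hs.tsum_eq]
      exact ENNReal.ofReal_tsum_of_nonneg
        (fun n => re_trace_comp_nonneg ρ.pos ρ.traceClass (M.pos _ (hB n))) hs.summable)

theorem POVM.law_apply (M : POVM H Ω) (ρ : DensityOperator H) {B : Set Ω} (hB : MeasurableSet B) :
    M.law ρ B = ENNReal.ofReal (trace (ρ.op ∘L M.eff B)).re :=
  Measure.ofMeasurable_apply B hB

end Measurements

section Observables

variable {H : Type*} [NormedAddCommGroup H] [InnerProductSpace ℂ H]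

/-- `ρ A ∈ 𝒯(H)` for a possibly unbounded operator `A`: the operator `ρ A`, defined on the domain
of `A`, extends to a trace-class operator. -/
def HasFiniteExpectation (ρ : H →L[ℂ] H) (A : H →ₗ.[ℂ] H) : Prop :=
  ∃ T : H →L[ℂ] H, IsTraceClass T ∧ ∀ x : A.domain, T x = ρ (A x)

/-- `A²`, on the domain of all `x ∈ dom A` with `A x ∈ dom A`. -/
def square (A : H →ₗ.[ℂ] H) : H →ₗ.[ℂ] H where
  domain :=
    { carrier := {x | ∃ h : x ∈ A.domain, A ⟨x, h⟩ ∈ A.domain}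
      zero_mem' := ⟨A.domain.zero_mem, by
        have : A ⟨0, A.domain.zero_mem⟩ = 0 := A.map_zero
        rw [this]; exact A.domain.zero_mem⟩
      add_mem' := by
        rintro x y ⟨hx, hx'⟩ ⟨hy, hy'⟩
        refine ⟨A.domain.add_mem hx hy, ?_⟩
        have : A ⟨x + y, A.domain.add_mem hx hy⟩ = A ⟨x, hx⟩ + A ⟨y, hy⟩ :=
          A.map_add ⟨x, hx⟩ ⟨y, hy⟩
        rw [this]; exact A.domain.add_mem hx' hy'
      smul_mem' := by
        rintro c x ⟨hx, hx'⟩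
        refine ⟨A.domain.smul_mem c hx, ?_⟩
        have : A ⟨c • x, A.domain.smul_mem c hx⟩ = c • A ⟨x, hx⟩ := A.map_smul c ⟨x, hx⟩
        rw [this]; exact A.domain.smul_mem c hx' }
  toFun :=
    { toFun := fun x => A ⟨A ⟨x.1, x.2.1⟩, x.2.2⟩
      map_add' := by
        rintro ⟨x, hx, hx'⟩ ⟨y, hy, hy'⟩
        rw [← LinearPMap.map_add]
        congr 1
        exact Subtype.ext (A.map_add ⟨x, hx⟩ ⟨y, hy⟩)
      map_smul' := by
        rintro c ⟨x, hx, hx'⟩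
        rw [RingHom.id_apply, ← LinearPMap.map_smul]
        congr 1
        exact Subtype.ext (A.map_smul c ⟨x, hx⟩) }

variable [CompleteSpace H]

/-- The observables `𝒪_ρ`: self-adjoint, possibly unbounded operators `A` with `ρ A` trace
class. -/
def observables (ρ : H →L[ℂ] H) : Set (H →ₗ.[ℂ] H) :=
  {A | IsSelfAdjoint A ∧ HasFiniteExpectation ρ A}

open Classical in
/-- The expectation value `⟨A⟩ = Tr[ρ A]`. -/
def expectation (ρ : H →L[ℂ] H) (A : H →ₗ.[ℂ] H) : ℂ :=
  if h : HasFiniteExpectation ρ A then trace h.choose else 0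

/-- The variance `σ²(A) = ⟨A²⟩ - ⟨A⟩²` of a self-adjoint operator `A`. -/
def variance (ρ : H →L[ℂ] H) (A : H →ₗ.[ℂ] H) : ℝ :=
  (expectation ρ (square A)).re - (expectation ρ A).re ^ 2

/-- `G = ∇_θ ⟨A⟩_θ`: the function `θ' ↦ ⟨A⟩_θ'`, on the set of those `θ' ∈ Θ` at which it is
defined, is Fréchet differentiable at `θ` with derivative `φ ↦ (G, φ)`. -/
def HasExpectationGradient (ρ₀ : DensityOperator H) (A : H →ₗ.[ℂ] H) (θ : Theta ρ₀)
    (G : Xi H) : Prop :=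
  HasFDerivWithinAt (fun θ' : Xi H => (expectation (ρ₀.op + θ'.op) A).re) (innerSL ℝ G)
    {θ' | θ' ∈ Theta ρ₀ ∧ A ∈ observables (ρ₀.op + θ'.op)} θ.1

end Observables

section Fisher

variable {H : Type*} [NormedAddCommGroup H] [InnerProductSpace ℂ H] [CompleteSpace H]
variable {Ω : Type*} [MeasurableSpace Ω]

/-- The outcome probability `P_θ(B) = Tr[ρ(θ) M(B)]` as a function of `θ`. -/
def prob (ρ₀ : DensityOperator H) (M : POVM H Ω) (B : Set Ω) (θ : Xi H) : ℝ :=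
  (trace ((ρ₀.op + θ.op) ∘L M.eff B)).re

/-- `κ` is the logarithmic gradient at `θ` of the family `P_θ(B) = Tr[ρ(θ) M(B)]`: for every
event `B` the function `θ' ↦ P_θ'(B)` on `Θ` is Fréchet differentiable at `θ`, and for every
direction `φ` the function `x ↦ (κ(x), φ)` is the Radon-Nikodym derivative of
`B ↦ D_θ P_θ(B)[φ]` with respect to `P_θ`. -/
structure IsLogGradient (ρ₀ : DensityOperator H) (M : POVM H Ω) (θ : Theta ρ₀)
    (κ : Ω → Xi H) : Prop where
  integrable : ∀ φ : Xi H, Integrable (fun x => ⟪κ x, φ⟫_ℝ) (M.law (state ρ₀ θ))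
  hasFDeriv : ∀ B, MeasurableSet B → ∃ D : Xi H →L[ℝ] ℝ,
    HasFDerivWithinAt (prob ρ₀ M B) D (Theta ρ₀) θ.1 ∧
      ∀ φ : Xi H, D φ = ∫ x in B, ⟪κ x, φ⟫_ℝ ∂(M.law (state ρ₀ θ))

/-- `J` is the Fisher information operator `E_θ[κ κ*]` at `θ`, where `κ` is the logarithmic
gradient and `‖κ‖ ∈ L²(P_θ)`; the expectation is understood weakly. -/
def IsFisherOperator (ρ₀ : DensityOperator H) (M : POVM H Ω) (θ : Theta ρ₀)
    (J : Xi H →ₗ[ℝ] Xi H) : Prop :=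
  ∃ κ : Ω → Xi H, IsLogGradient ρ₀ M θ κ ∧
    MemLp (fun x => ‖κ x‖) 2 (M.law (state ρ₀ θ)) ∧
    ∀ φ χ : Xi H, ⟪φ, J χ⟫_ℝ = ∫ x, ⟪κ x, φ⟫_ℝ * ⟪κ x, χ⟫_ℝ ∂(M.law (state ρ₀ θ))

open Classical in
/-- The Fisher information operator `J^M_θ` (zero if there is none). -/
def fisherOperator (ρ₀ : DensityOperator H) (M : POVM H Ω) (θ : Theta ρ₀) :
    Xi H →ₗ[ℝ] Xi H :=
  if h : ∃ J, IsFisherOperator ρ₀ M θ J then h.choose else 0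

/-- The four Moore-Penrose conditions. -/
structure IsMoorePenroseInverse {E : Type*} [NormedAddCommGroup E] [InnerProductSpace ℝ E]
    (J K : E →ₗ[ℝ] E) : Prop where
  mul_mul_left : J ∘ₗ K ∘ₗ J = J
  mul_mul_right : K ∘ₗ J ∘ₗ K = K
  symm_left : (J ∘ₗ K).IsSymmetric
  symm_right : (K ∘ₗ J).IsSymmetric

open Classical in
/-- The Moore-Penrose inverse (unique if it exists; zero if it does not exist). -/
def moorePenrose {E : Type*} [NormedAddCommGroup E] [InnerProductSpace ℝ E]
    (J : E →ₗ[ℝ] E) : E →ₗ[ℝ] E :=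
  if h : ∃ K, IsMoorePenroseInverse J K then h.choose else 0

open Classical in
/-- The measurement error `ε(A; ρ(θ), M)`: it is `(G, (J^M_θ)⁺ G) - σ²_θ(A)` if the gradient
`G = ∇_θ ⟨A⟩_θ` lies in `(ker J^M_θ)^⊥`, and `+∞` otherwise. -/
def measurementError (ρ₀ : DensityOperator H) (M : POVM H Ω) (θ : Theta ρ₀)
    (A : H →ₗ.[ℂ] H) : EReal :=
  if h : ∃ G : Xi H, HasExpectationGradient ρ₀ A θ G ∧
      G ∈ (LinearMap.ker (fisherOperator ρ₀ M θ))ᗮ then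
    ((⟪h.choose, moorePenrose (fisherOperator ρ₀ M θ) h.choose⟫_ℝ
      - variance (state ρ₀ θ).op A : ℝ) : EReal)
  else ⊤

end Fisher

end QuantumEstimation

end

open QuantumEstimation

/-! Write `ρ` for the state at `θ`. A gradient `G` of the expectation of `A` already forces `A` to
be bounded. Move from `ρ` towards `|x⟩⟨x|` with `x` in the domain of `A`: the expectation is affine
along this segment, so its slope can be compared with the value of `G` on the direction. This shows
that the quadratic forms of `A` and of `G + c` agree on the domain, for one real constant `c`.
Polarization gives `A = G + c` there, and self-adjointness makes the domain all of `H`. Hence `ρ A²`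
is trace class, and with `S = G - Tr[ρG]` the variance is `Tr[ρS²]`.

The inequality comes from the direction `φ = (ρS + Sρ)/2`, for which `(G, φ) = Tr[ρS²]`. Put `g =
(κ, φ)`. For every `f` in `L²(P_θ)`, `2 ∫ f g - ∫ f² ≤ Tr[SρS]`: for simple `f` this is the sum,
over the values `c` of `f`, of `Tr[(S - c) ρ (S - c) M(f = c)] ≥ 0`, and density gives the rest
(`two_mul_integral_sub_le`). Take `f = (κ, J⁺G)`. Since `J J⁺ G = G` for `G` orthogonal to `ker J`,
the bound reads `2 σ² - (G, J⁺G) ≤ σ²`, which is the claim.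

The identity `2 ∫_B g = Tr[(ρS + Sρ) M(B)]` needs care, because differentiability is only known
within `Θ`, and `θ + tφ` may leave `Θ` for every small `t ≠ 0`. The curve of states proportional to
`(1 + tS/2) ρ (1 + tS/2)` has tangent `φ` at `t = 0` and stays in `Θ` (`curve_mem_Theta`). -/

namespace QuantumEstimation

open Filter Topology MeasureTheory

/-! ### Trace-class operators, cyclicity of the trace, expectations. -/

section Trace

variable {H : Type*} [NormedAddCommGroup H] [InnerProductSpace ℂ H]

/-- The rank-one operator `v ↦ ⟨y, v⟩ x`. -/
noncomputable def rankOne (x y : H) : H →L[ℂ] H := (innerSL ℂ y).smulRight x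

theorem rankOne_apply (x y v : H) : rankOne x y v = ⟪y, v⟫_ℂ • x := rfl

theorem isTraceClass_rankOne (x y : H) : IsTraceClass (rankOne x y) := by
  refine ⟨Pi.single 0 x, Pi.single 0 y, ?_, fun v => ?_⟩
  · refine summable_of_ne_finset_zero (s := {0}) fun n hn => ?_
    have hn : n ≠ 0 := by simpa using hn
    simp [hn]
  · have := hasSum_single (f := fun n => ⟪Pi.single (M := fun _ : ℕ => H) 0 y n, v⟫_ℂ •
      Pi.single (M := fun _ : ℕ => H) 0 x n) 0 (fun n hn => by simp [hn])
    simpa [rankOne_apply] using this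

variable [CompleteSpace H]

theorem IsTraceClass.comp_clm {T : H →L[ℂ] H} (hT : IsTraceClass T) (S : H →L[ℂ] H) :
    IsTraceClass (T ∘L S) := by
  obtain ⟨x, y, h, hx⟩ := hT
  refine ⟨x, fun n => S.adjoint (y n), ?_, fun v => ?_⟩
  · refine Summable.of_nonneg_of_le (fun n => by positivity) (fun n => ?_)
      (h.mul_left ‖S.adjoint‖)
    calc ‖x n‖ * ‖S.adjoint (y n)‖ ≤ ‖x n‖ * (‖S.adjoint‖ * ‖y n‖) := by
          gcongr; exact ContinuousLinearMap.le_opNorm _ _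
      _ = _ := by ring
  · simpa [ContinuousLinearMap.adjoint_inner_left] using hx (S v)

/-- Both traces equal `∑ ⟨yₙ, S xₙ⟩` for any nuclear representation of `T`. -/
theorem trace_comp_comm {T : H →L[ℂ] H} (hT : IsTraceClass T) (S : H →L[ℂ] H) :
    trace (S ∘L T) = trace (T ∘L S) := by
  obtain ⟨x, y, h, hx⟩ := hT
  rw [trace_comp_eq h hx]
  refine (hasSum_diag (x := fun n => S (x n)) (y := y) ?_ fun v => ?_).tsum_eq
  · refine Summable.of_nonneg_of_le (fun n => by positivity) (fun n => ?_) (h.mul_left ‖S‖)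
    calc ‖S (x n)‖ * ‖y n‖ ≤ (‖S‖ * ‖x n‖) * ‖y n‖ := by gcongr; exact S.le_opNorm _
      _ = _ := by ring
  · simpa using (hx v).mapL S

theorem trace_rankOne (x y : H) : trace (rankOne x y) = ⟪y, x⟫_ℂ := by
  rw [← (basis H).tsum_inner_mul_inner y x]
  exact tsum_congr fun i => by rw [rankOne_apply, inner_smul_right]

omit [CompleteSpace H] in
theorem comp_rankOne (S : H →L[ℂ] H) (x y : H) : S ∘L rankOne x y = rankOne (S x) y := by
  ext v; simp [rankOne_apply]

theorem trace_adjoint (T : H →L[ℂ] H) : trace T.adjoint = star (trace T) := by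
  rw [trace, trace, tsum_star]
  refine tsum_congr fun i => ?_
  rw [ContinuousLinearMap.adjoint_inner_right, ← inner_conj_symm]
  rfl

theorem trace_of_isSelfAdjoint {T : H →L[ℂ] H} (hT : IsSelfAdjoint T) :
    trace T = ((trace T).re : ℂ) := by
  have h := trace_adjoint T
  rw [hT.adjoint_eq] at h
  exact (Complex.conj_eq_iff_re.1 h.symm).symm

theorem isSelfAdjoint_rankOne_self (x : H) : IsSelfAdjoint (rankOne x x) := by
  refine (ContinuousLinearMap.isSelfAdjoint_iff_isSymmetric).2 fun u v => ?_
  simp [rankOne_apply, inner_smul_left, inner_smul_right, mul_comm]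

theorem re_trace_smul (c : ℝ) (T : H →L[ℂ] H) : (trace ((c : ℂ) • T)).re = c * (trace T).re := by
  rw [trace_smul, Complex.re_ofReal_mul]

theorem isSelfAdjoint_real_smul (c : ℝ) {T : H →L[ℂ] H} (hT : IsSelfAdjoint T) :
    IsSelfAdjoint ((c : ℂ) • T) := by
  rw [IsSelfAdjoint, star_smul, hT.star_eq, Complex.star_def, Complex.conj_ofReal]

omit [CompleteSpace H] in
theorem HasFiniteExpectation.unique {ρ S T : H →L[ℂ] H} {A : H →ₗ.[ℂ] H}
    (hA : Dense (A.domain : Set H)) (hS : ∀ x : A.domain, S x = ρ (A x))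
    (hT : ∀ x : A.domain, T x = ρ (A x)) : S = T :=
  ContinuousLinearMap.coeFn_injective <| S.continuous.ext_on hA T.continuous fun x hx =>
    (hS ⟨x, hx⟩).trans (hT ⟨x, hx⟩).symm

/-- The definition chooses an arbitrary trace-class extension of `ρ A`; density of the domain makes
the choice immaterial. -/
theorem expectation_eq_trace {ρ T : H →L[ℂ] H} {A : H →ₗ.[ℂ] H}
    (hA : Dense (A.domain : Set H)) (ht : IsTraceClass T)
    (hT : ∀ x : A.domain, T x = ρ (A x)) : expectation ρ A = trace T := by
  have h : HasFiniteExpectation ρ A := ⟨T, ht, hT⟩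
  rw [expectation, dif_pos h, HasFiniteExpectation.unique hA h.choose_spec.2 hT]

end Trace

/-! ### Derivatives along one-sided curves. -/

section Derivatives

/-- A derivative within a set is determined along curves that stay in it to one side. -/
theorem hasFDerivWithinAt_apply_eq_of_curve {E : Type*} [NormedAddCommGroup E]
    [NormedSpace ℝ E] {F : E → ℝ} {D : E →L[ℝ] ℝ} {s : Set E} {θ φ : E}
    (hF : HasFDerivWithinAt F D s θ) {γ : ℝ → E} (h0 : γ 0 = θ) (hγ : HasDerivAt γ φ 0)
    (hs : ∀ᶠ t in 𝓝[≥] (0 : ℝ), γ t ∈ s) {q : ℝ → ℝ} {r : ℝ} (hq : HasDerivAt q r 0)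
    (hFq : ∀ᶠ t in 𝓝[≥] (0 : ℝ), F (γ t) = q t) : D φ = r := by
  obtain ⟨ε, hε, hsub⟩ := (mem_nhdsGE_iff_exists_Ico_subset (a := (0 : ℝ))).1 (hs.and hFq)
  have hε : (0 : ℝ) < ε := hε
  -- The half-open interval `[0, ε)` has unique derivatives at its left endpoint, so nonnegative `t`
  -- suffice.
  have h1 : HasDerivWithinAt (F ∘ γ) (D φ) (Set.Ico 0 ε) 0 := by
    refine HasFDerivWithinAt.comp_hasDerivWithinAt (t := s) 0 (by rwa [h0])
      hγ.hasDerivWithinAt fun t ht => (hsub ht).1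
  have h2 : HasDerivWithinAt (F ∘ γ) r (Set.Ico 0 ε) 0 :=
    hq.hasDerivWithinAt.congr (fun t ht => (hsub ht).2) (hsub ⟨le_rfl, hε⟩).2
  exact (uniqueDiffOn_Ico (0 : ℝ) ε 0 ⟨le_rfl, hε⟩).eq_deriv _ h1 h2

end Derivatives

/-! ### Segments in `Θ` towards vector states. -/

section Parameters

variable {H : Type*} [NormedAddCommGroup H] [InnerProductSpace ℂ H] [CompleteSpace H]

/-- The element of `Ξ` given by a self-adjoint trace-class operator of trace zero. -/
def Xi.ofOp (T : H →L[ℂ] H) (hsa : IsSelfAdjoint T) (htc : IsTraceClass T) (htr : trace T = 0) :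
    Xi H :=
  (⟨T, hsa, htc, htr⟩ : tangentSubmodule H)

theorem Xi.op_ofOp (T : H →L[ℂ] H) (hsa : IsSelfAdjoint T) (htc : IsTraceClass T)
    (htr : trace T = 0) : (Xi.ofOp T hsa htc htr).op = T := rfl

/-- The direction `|x⟩⟨x| - ‖x‖² ρ` from a state `ρ` towards a vector state. -/
noncomputable def DensityOperator.towards (ρ : DensityOperator H) (x : H) : Xi H :=
  Xi.ofOp (rankOne x x + ((-‖x‖ ^ 2 : ℝ) : ℂ) • ρ.op)
    ((isSelfAdjoint_rankOne_self x).add (isSelfAdjoint_real_smul _ ρ.pos.isSelfAdjoint))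
    ((isTraceClass_rankOne x x).add (ρ.traceClass.smul _)) (by
      rw [trace_add (isTraceClass_rankOne x x) (ρ.traceClass.smul _), trace_smul,
        ρ.trace_eq_one, trace_rankOne, inner_self_eq_norm_sq_to_K]
      simp)

theorem DensityOperator.op_towards (ρ : DensityOperator H) (x : H) :
    (ρ.towards x).op = rankOne x x + ((-‖x‖ ^ 2 : ℝ) : ℂ) • ρ.op := rfl

theorem op_add_smul_towards (ρ₀ : DensityOperator H) (θ : Theta ρ₀) (x : H) (t : ℝ) :
    ρ₀.op + (θ.1 + t • (state ρ₀ θ).towards x).op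
      = ((1 - t * ‖x‖ ^ 2 : ℝ) : ℂ) • (state ρ₀ θ).op + (t : ℂ) • rankOne x x := by
  rw [Xi.op_add, Xi.op_smul, DensityOperator.op_towards, ← add_assoc]
  change (state ρ₀ θ).op + _ = _
  push_cast
  module

theorem add_smul_towards_mem_Theta (ρ₀ : DensityOperator H) (θ : Theta ρ₀) (x : H) {t : ℝ}
    (ht : 0 ≤ t) (ht' : t * ‖x‖ ^ 2 < 1) :
    θ.1 + t • (state ρ₀ θ).towards x ∈ Theta ρ₀ := by
  intro v hv
  have h1 : 0 < (⟪(state ρ₀ θ).op v, v⟫_ℂ).re := θ.2 v hv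
  rw [op_add_smul_towards]
  simp only [add_apply, smul_apply, inner_add_left, inner_smul_left, Complex.conj_ofReal,
    Complex.add_re, Complex.re_ofReal_mul, rankOne_apply]
  have h2 : ((starRingEnd ℂ) ⟪x, v⟫_ℂ * ⟪x, v⟫_ℂ).re = ‖⟪x, v⟫_ℂ‖ ^ 2 := by
    rw [← Complex.normSq_eq_conj_mul_self, Complex.ofReal_re, Complex.normSq_eq_norm_sq]
  rw [h2]
  have : 0 < 1 - t * ‖x‖ ^ 2 := by linarith
  positivity

end Parameters

/-! ### An observable with a gradient is bounded. -/

section Gradient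

variable {H : Type*} [NormedAddCommGroup H] [InnerProductSpace ℂ H] [CompleteSpace H]

theorem isFormalAdjoint_self {A : H →ₗ.[ℂ] H} (hA : IsSelfAdjoint A) : A.IsFormalAdjoint A := by
  have h := LinearPMap.adjoint_isFormalAdjoint hA.dense_domain
  rwa [LinearPMap.isSelfAdjoint_def.1 hA] at h

/-- By symmetry of `A`, `|x⟩⟨x| A` extends to the rank-one operator `|x⟩⟨Ax|` when `x` is in the
domain. The states on the segment towards `x` therefore keep `A` among their observables. -/
theorem hasFiniteExpectation_towards {ρ T : H →L[ℂ] H} {A : H →ₗ.[ℂ] H} (hA : IsSelfAdjoint A)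
    (hT : ∀ x : A.domain, T x = ρ (A x)) (x : A.domain) (a b : ℂ) (v : A.domain) :
    (a • T + b • rankOne (x : H) (A x)) v = (a • ρ + b • rankOne (x : H) x) (A v) := by
  have h : ⟪A x, (v : H)⟫_ℂ = ⟪(x : H), A v⟫_ℂ := isFormalAdjoint_self hA x v
  simp [rankOne_apply, hT, h]

/-- The gradient determines the quadratic form of an observable up to a constant. -/
theorem re_inner_eq_of_hasExpectationGradient {ρ₀ : DensityOperator H} {A : H →ₗ.[ℂ] H}
    {θ : Theta ρ₀} {G : Xi H} {T : H →L[ℂ] H} (hA : IsSelfAdjoint A) (ht : IsTraceClass T)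
    (hT : ∀ x : A.domain, T x = (state ρ₀ θ).op (A x)) (hG : HasExpectationGradient ρ₀ A θ G)
    (x : A.domain) :
    (⟪(x : H), A x⟫_ℂ).re = (⟪(x : H), G.op x⟫_ℂ).re
      + ((trace T).re - (trace (G.op ∘L (state ρ₀ θ).op)).re) * ‖(x : H)‖ ^ 2 := by
  set ρ := state ρ₀ θ with hρ
  have hsmall : ∀ᶠ t in 𝓝[≥] (0 : ℝ), 0 ≤ t ∧ t * ‖(x : H)‖ ^ 2 < 1 := by
    refine eventually_mem_nhdsWithin.and (nhdsWithin_le_nhds ?_)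
    have : ContinuousAt (fun t : ℝ => t * ‖(x : H)‖ ^ 2) 0 := by fun_prop
    exact this.eventually_lt continuousAt_const (by simp)
  have htc : ∀ a b : ℂ, IsTraceClass (a • T + b • rankOne (x : H) (A x)) := fun a b =>
    (ht.smul a).add ((isTraceClass_rankOne _ _).smul b)
  -- First evaluation of the slope: along the segment the expectation is exactly affine in `t`.
  have key : innerSL ℝ G (ρ.towards x)
      = -‖(x : H)‖ ^ 2 * (trace T).re + (⟪A x, (x : H)⟫_ℂ).re := by
    refine hasFDerivWithinAt_apply_eq_of_curve hG (γ := fun t => θ.1 + t • ρ.towards x)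
      (q := fun t => (1 - t * ‖(x : H)‖ ^ 2) * (trace T).re + t * (⟪A x, (x : H)⟫_ℂ).re)
      (by simp) ?_ ?_ ?_ ?_
    · simpa using ((hasDerivAt_id (0 : ℝ)).smul_const (ρ.towards (x : H))).const_add θ.1
    · filter_upwards [hsmall] with t ht
      refine ⟨add_smul_towards_mem_Theta ρ₀ θ x ht.1 ht.2, hA, _,
        htc ((1 - t * ‖(x : H)‖ ^ 2 : ℝ) : ℂ) t, fun v => ?_⟩
      rw [op_add_smul_towards]
      exact hasFiniteExpectation_towards hA hT x _ _ v
    · have h1 := (((hasDerivAt_id (0 : ℝ)).mul_const (‖(x : H)‖ ^ 2)).const_sub 1).mul_const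
        (trace T).re
      have h2 := (hasDerivAt_id (0 : ℝ)).mul_const (⟪A x, (x : H)⟫_ℂ).re
      refine (h1.fun_add h2).congr_deriv ?_
      simp
    · filter_upwards with t
      rw [op_add_smul_towards, expectation_eq_trace hA.dense_domain (htc _ _)
        (hasFiniteExpectation_towards hA hT x _ _),
        trace_add (ht.smul _) ((isTraceClass_rankOne _ _).smul _), Complex.add_re,
        re_trace_smul, re_trace_smul, trace_rankOne]
  -- Second evaluation: the Hilbert–Schmidt product of `G` with the direction, expanded.
  have h2 : innerSL ℝ G (ρ.towards x) = (⟪(x : H), G.op x⟫_ℂ).re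
      - ‖(x : H)‖ ^ 2 * (trace (G.op ∘L ρ.op)).re := by
    rw [innerSL_apply_apply, Xi.inner_def, DensityOperator.op_towards, ContinuousLinearMap.comp_add,
      ContinuousLinearMap.comp_smul, comp_rankOne, trace_add (isTraceClass_rankOne _ _)
      ((ρ.traceClass.clm_comp _).smul _), Complex.add_re, re_trace_smul, trace_rankOne]
    ring
  have h3 : ⟪A x, (x : H)⟫_ℂ = ⟪(x : H), A x⟫_ℂ := isFormalAdjoint_self hA x x
  rw [h3] at key
  linarith

omit [CompleteSpace H] in
-- Expanding the form at `x + y` and using symmetry leaves `2 Re ⟨y, Bx⟩ = 0` for `y` in `p`. By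
-- density this holds for every `y` in `H`, in particular for `y = Bx`, which need not lie in `p`.
theorem eq_zero_of_symmetric_of_re_inner_eq_zero {p : Submodule ℂ H} (hp : Dense (p : Set H))
    (B : p →ₗ[ℂ] H) (hs : ∀ x y : p, ⟪B x, (y : H)⟫_ℂ = ⟪(x : H), B y⟫_ℂ)
    (h0 : ∀ x : p, (⟪(x : H), B x⟫_ℂ).re = 0) (x : p) : B x = 0 := by
  have h1 : ∀ y : p, (⟪(y : H), B x⟫_ℂ).re = 0 := fun y => by
    have h := h0 (x + y)
    rw [map_add, Submodule.coe_add, inner_add_left, inner_add_right, inner_add_right,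
      ← hs x y, ← inner_conj_symm (B x)] at h
    simp only [Complex.add_re, Complex.conj_re, h0] at h
    linarith
  have h2 : ∀ y : H, (⟪y, B x⟫_ℂ).re = 0 := fun y =>
    congrFun ((Complex.continuous_re.comp (by fun_prop :
      Continuous fun y : H => ⟪y, B x⟫_ℂ)).ext_on hp continuous_const fun y hy => h1 ⟨y, hy⟩) y
  have h3 := h2 (B x)
  exact inner_self_eq_zero.1 ((inner_self_ofReal_re (𝕜 := ℂ) (B x)).symm.trans (by simpa using h3))

/-- An observable with a gradient `G` is `G` up to a real constant; in particular bounded. -/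
theorem exists_eq_add_smul_of_hasExpectationGradient {ρ₀ : DensityOperator H} {A : H →ₗ.[ℂ] H}
    {θ : Theta ρ₀} {G : Xi H} (hA : A ∈ observables (state ρ₀ θ).op)
    (hG : HasExpectationGradient ρ₀ A θ G) :
    ∃ c : ℝ, ∀ x : A.domain, A x = G.op x + (c : ℂ) • (x : H) := by
  obtain ⟨hsa, T, ht, hT⟩ := hA
  set c := (trace T).re - (trace (G.op ∘L (state ρ₀ θ).op)).re
  refine ⟨c, fun x => ?_⟩
  let B : A.domain →ₗ[ℂ] H := A.toFun
    - (G.op + (c : ℂ) • ContinuousLinearMap.id ℂ H).toLinearMap ∘ₗ A.domain.subtype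
  have hB : ∀ x : A.domain, B x = A x - (G.op x + (c : ℂ) • (x : H)) := fun x => rfl
  have hGs : ∀ u v, ⟪G.op u, v⟫_ℂ = ⟪u, G.op v⟫_ℂ :=
    ContinuousLinearMap.isSelfAdjoint_iff_isSymmetric.1 G.isSelfAdjoint
  have := eq_zero_of_symmetric_of_re_inner_eq_zero hsa.dense_domain B (fun x y => by
    have h : ⟪A x, (y : H)⟫_ℂ = ⟪(x : H), A y⟫_ℂ := isFormalAdjoint_self hsa x y
    simp only [hB, inner_sub_left, inner_sub_right, inner_add_left, inner_add_right, h, hGs,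
      inner_smul_left, inner_smul_right, Complex.conj_ofReal]) (fun x => by
    have h := re_inner_eq_of_hasExpectationGradient hsa ht hT hG x
    have hn : (⟪(x : H), x⟫_ℂ).re = ‖(x : H)‖ ^ 2 := inner_self_eq_norm_sq (𝕜 := ℂ) _
    rw [hB, inner_sub_right, inner_add_right, inner_smul_right, Complex.sub_re, Complex.add_re,
      Complex.re_ofReal_mul, h, hn]
    ring) x
  rw [hB] at this
  exact sub_eq_zero.1 this

/-- The functional `x ↦ ⟨y, Ax⟩` is continuous for every `y`, so every `y` lies in the domain of the
adjoint, which is that of `A`. -/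
theorem domain_eq_top_of_eq_clm {A : H →ₗ.[ℂ] H} (hA : IsSelfAdjoint A) (a : H →L[ℂ] H)
    (h : ∀ x : A.domain, A x = a x) : A.domain = ⊤ := by
  rw [← LinearPMap.isSelfAdjoint_def.1 hA, Submodule.eq_top_iff']
  intro y
  rw [LinearPMap.mem_adjoint_domain_iff]
  have h2 : ((innerₛₗ ℂ y).comp A.toFun : A.domain → ℂ) = fun x : A.domain => ⟪y, a x⟫_ℂ :=
    funext fun x => congrArg (fun z => ⟪y, z⟫_ℂ) (h x)
  rw [h2]
  fun_prop

omit [CompleteSpace H] in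
theorem square_domain_eq_top {A : H →ₗ.[ℂ] H} (h : A.domain = ⊤) : (square A).domain = ⊤ :=
  have hm : ∀ x, x ∈ A.domain := fun x => by rw [h]; exact Submodule.mem_top
  Submodule.eq_top_iff'.2 fun x => ⟨hm x, hm _⟩

end Gradient

/-! ### Variance of a bounded observable. -/

section Variance

variable {H : Type*} [NormedAddCommGroup H] [InnerProductSpace ℂ H] [CompleteSpace H]

/-- Used with `X` the effect of the event on which a simple function takes the value `c`; the left
side is then nonnegative. -/
theorem DensityOperator.trace_comp_conj (ρ : DensityOperator H) (S X : H →L[ℂ] H) (c : ℝ) :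
    (trace (((S - (c : ℂ) • ContinuousLinearMap.id ℂ H) ∘L ρ.op ∘L
        (S - (c : ℂ) • ContinuousLinearMap.id ℂ H)) ∘L X)).re
      = (trace ((S ∘L ρ.op ∘L S) ∘L X)).re
        - c * (trace ((ρ.op ∘L S + S ∘L ρ.op) ∘L X)).re + c ^ 2 * (trace (ρ.op ∘L X)).re := by
  have h1 : IsTraceClass ((S ∘L ρ.op ∘L S) ∘L X) :=
    ((ρ.traceClass.comp_clm S).clm_comp S).comp_clm X
  have h2 : IsTraceClass ((ρ.op ∘L S + S ∘L ρ.op) ∘L X) :=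
    ((ρ.traceClass.comp_clm S).add (ρ.traceClass.clm_comp S)).comp_clm X
  have h3 : IsTraceClass (ρ.op ∘L X) := ρ.traceClass.comp_clm X
  have e : ((S - (c : ℂ) • ContinuousLinearMap.id ℂ H) ∘L ρ.op ∘L
        (S - (c : ℂ) • ContinuousLinearMap.id ℂ H)) ∘L X
      = (S ∘L ρ.op ∘L S) ∘L X + ((-c : ℝ) : ℂ) • ((ρ.op ∘L S + S ∘L ρ.op) ∘L X)
        + ((c ^ 2 : ℝ) : ℂ) • (ρ.op ∘L X) := by
    ext v
    simp only [ContinuousLinearMap.comp_apply, add_apply, sub_apply, smul_apply, map_sub, map_smul,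
      ContinuousLinearMap.id_apply]
    push_cast
    module
  rw [e, trace_add (h1.add (h2.smul _)) (h3.smul _), trace_add h1 (h2.smul _), Complex.add_re,
    Complex.add_re, re_trace_smul, re_trace_smul]
  ring

theorem isPositive_conj_of_isSelfAdjoint {ρ S : H →L[ℂ] H} (hρ : ρ.IsPositive)
    (hS : IsSelfAdjoint S) : (S ∘L ρ ∘L S).IsPositive := by
  have := hρ.conj_adjoint S
  rwa [hS.adjoint_eq] at this

theorem DensityOperator.trace_comp_eq_ofReal_re (ρ : DensityOperator H) {S : H →L[ℂ] H}
    (hS : IsSelfAdjoint S) : trace (ρ.op ∘L S) = ((trace (ρ.op ∘L S)).re : ℂ) := by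
  have h := trace_adjoint (ρ.op ∘L S)
  rw [ContinuousLinearMap.adjoint_comp, hS.adjoint_eq, ρ.pos.isSelfAdjoint.adjoint_eq,
    trace_comp_comm ρ.traceClass S] at h
  exact (Complex.conj_eq_iff_re.1 h.symm).symm

/-- Variance ignores constants: since `S` has mean zero, `⟨A⟩ = e` and `⟨A²⟩ = Tr[ρS²] + e²`. -/
theorem variance_eq {ρ : DensityOperator H} {A : H →ₗ.[ℂ] H} (hA : A.domain = ⊤)
    {S : H →L[ℂ] H} (hS0 : trace (ρ.op ∘L S) = 0) (e : ℝ)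
    (hS : ∀ x : A.domain, A x = S x + (e : ℂ) • (x : H)) :
    HasFiniteExpectation ρ.op (square A) ∧
      variance ρ.op A = (trace (ρ.op ∘L S ∘L S)).re := by
  set a : H →L[ℂ] H := S + (e : ℂ) • ContinuousLinearMap.id ℂ H with ha
  have haA : ∀ x : A.domain, A x = a x := fun x => hS x
  have h1 : ∀ x : A.domain, (ρ.op ∘L a) x = ρ.op (A x) := fun x => by rw [haA]; rfl
  have h2 : ∀ x : (square A).domain, (ρ.op ∘L a ∘L a) x = ρ.op (square A x) := fun x => by
    have : square A x = A ⟨A ⟨x.1, x.2.1⟩, x.2.2⟩ := rfl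
    rw [this, haA]
    have h3 := haA ⟨x.1, x.2.1⟩
    simp only [ContinuousLinearMap.comp_apply, h3]
  have htc := ρ.traceClass.comp_clm
  refine ⟨⟨_, htc (a ∘L a), h2⟩, ?_⟩
  have e1 : ρ.op ∘L a = ρ.op ∘L S + (e : ℂ) • ρ.op := by
    ext v; simp [ha]
  have e2 : ρ.op ∘L a ∘L a = ρ.op ∘L S ∘L S + ((2 * e : ℝ) : ℂ) • (ρ.op ∘L S)
      + ((e ^ 2 : ℝ) : ℂ) • ρ.op := by
    ext v
    simp only [ha, ContinuousLinearMap.comp_apply, add_apply, smul_apply, map_add, map_smul,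
      ContinuousLinearMap.id_apply]
    push_cast
    module
  rw [variance, expectation_eq_trace (by rw [hA]; exact dense_univ) (htc a) h1,
    expectation_eq_trace (by rw [square_domain_eq_top hA]; exact dense_univ) (htc (a ∘L a)) h2,
    e1, e2, trace_add ((htc _).add ((htc _).smul _)) (ρ.traceClass.smul _),
    trace_add (htc _) ((htc _).smul _), trace_add (htc _) (ρ.traceClass.smul _),
    trace_smul, trace_smul, trace_smul, hS0, ρ.trace_eq_one]
  simp [-Complex.ofReal_pow]

end Variance

/-! ### The direction `(ρS + Sρ)/2` and a curve in `Θ` tangent to it. -/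

section Score

variable {H : Type*} [NormedAddCommGroup H] [InnerProductSpace ℂ H] [CompleteSpace H]

/-- The direction `(ρS + Sρ)/2` for a bounded observable `S` of mean zero. -/
noncomputable def DensityOperator.symmProd (ρ : DensityOperator H) (S : H →L[ℂ] H)
    (hS : IsSelfAdjoint S) (hS0 : trace (ρ.op ∘L S) = 0) : Xi H :=
  Xi.ofOp (((1 / 2 : ℝ) : ℂ) • (ρ.op ∘L S + S ∘L ρ.op))
    (isSelfAdjoint_real_smul _ (by
      have h : (ρ.op ∘L S).adjoint = S ∘L ρ.op := by
        rw [ContinuousLinearMap.adjoint_comp, hS.adjoint_eq, ρ.pos.isSelfAdjoint.adjoint_eq]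
      rw [← h]
      exact IsSelfAdjoint.add_star_self (ρ.op ∘L S)))
    (((ρ.traceClass.comp_clm S).add (ρ.traceClass.clm_comp S)).smul _) (by
      rw [trace_smul, trace_add (ρ.traceClass.comp_clm S) (ρ.traceClass.clm_comp S),
        trace_comp_comm ρ.traceClass, hS0]
      simp)

/-- The second-order correction `SρS/4 - Tr[SρS]/4 ρ`. -/
noncomputable def DensityOperator.secondOrder (ρ : DensityOperator H) (S : H →L[ℂ] H)
    (hS : IsSelfAdjoint S) : Xi H :=
  Xi.ofOp (((1 / 4 : ℝ) : ℂ) • (S ∘L ρ.op ∘L S)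
      + ((-((trace (S ∘L ρ.op ∘L S)).re / 4) : ℝ) : ℂ) • ρ.op)
    ((isSelfAdjoint_real_smul _ (isPositive_conj_of_isSelfAdjoint ρ.pos hS).isSelfAdjoint).add
      (isSelfAdjoint_real_smul _ ρ.pos.isSelfAdjoint))
    ((((ρ.traceClass.comp_clm S).clm_comp S).smul _).add (ρ.traceClass.smul _)) (by
      rw [trace_add (((ρ.traceClass.comp_clm S).clm_comp S).smul _) (ρ.traceClass.smul _),
        trace_smul, trace_smul, ρ.trace_eq_one, trace_of_isSelfAdjoint
          (isPositive_conj_of_isSelfAdjoint ρ.pos hS).isSelfAdjoint]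
      push_cast
      simp only [Complex.ofReal_re]
      ring)

/-- With `φ = (ρS + Sρ)/2`, one has `(1 + tS/2) ρ (1 + tS/2) = ρ + tφ + t² SρS/4`. Its trace is `1 +
t² n` because `φ` is traceless; dividing by it and subtracting `ρ` gives the two coefficients. -/
theorem op_add_curve (ρ₀ : DensityOperator H) (θ : Theta ρ₀) {S : H →L[ℂ] H}
    (hS : IsSelfAdjoint S) (hS0 : trace ((state ρ₀ θ).op ∘L S) = 0) {n t : ℝ}
    (hn : n = (trace (S ∘L (state ρ₀ θ).op ∘L S)).re / 4) (h : 1 + t ^ 2 * n ≠ 0) :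
    ρ₀.op + (θ.1 + (t / (1 + t ^ 2 * n)) • (state ρ₀ θ).symmProd S hS hS0
        + (t ^ 2 / (1 + t ^ 2 * n)) • (state ρ₀ θ).secondOrder S hS).op
      = ((1 / (1 + t ^ 2 * n) : ℝ) : ℂ) •
        ((ContinuousLinearMap.id ℂ H + ((t / 2 : ℝ) : ℂ) • S) ∘L (state ρ₀ θ).op ∘L
          (ContinuousLinearMap.id ℂ H + ((t / 2 : ℝ) : ℂ) • S)) := by
  have e0 : ρ₀.op + θ.1.op = (state ρ₀ θ).op := rfl
  have h1 : (1 + (t : ℂ) ^ 2 * n) ≠ 0 := by exact_mod_cast h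
  rw [Xi.op_add, Xi.op_add, Xi.op_smul, Xi.op_smul, ← add_assoc, ← add_assoc, e0,
    DensityOperator.symmProd, DensityOperator.secondOrder, Xi.op_ofOp, Xi.op_ofOp, ← hn]
  ext v
  simp only [ContinuousLinearMap.comp_apply, add_apply, smul_apply, map_add, map_smul,
    ContinuousLinearMap.id_apply]
  push_cast
  match_scalars <;> field_simp <;> ring

/-- For small `t` the operator `R = 1 + tS/2` is injective, so the form of `RρR` at `v`, being that
of `ρ` at `Rv ≠ 0`, is strictly positive. -/
theorem curve_mem_Theta (ρ₀ : DensityOperator H) (θ : Theta ρ₀) {S : H →L[ℂ] H}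
    (hS : IsSelfAdjoint S) (hS0 : trace ((state ρ₀ θ).op ∘L S) = 0) {n t : ℝ}
    (hn : n = (trace (S ∘L (state ρ₀ θ).op ∘L S)).re / 4) (h : 0 < 1 + t ^ 2 * n)
    (ht : |t| * ‖S‖ < 1) :
    θ.1 + (t / (1 + t ^ 2 * n)) • (state ρ₀ θ).symmProd S hS hS0
        + (t ^ 2 / (1 + t ^ 2 * n)) • (state ρ₀ θ).secondOrder S hS ∈ Theta ρ₀ := by
  intro v hv
  rw [op_add_curve ρ₀ θ hS hS0 hn h.ne']
  set R := ContinuousLinearMap.id ℂ H + ((t / 2 : ℝ) : ℂ) • S with hR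
  have hRs : IsSelfAdjoint R := (IsSelfAdjoint.one (H →L[ℂ] H)).add (isSelfAdjoint_real_smul _ hS)
  have hRv : R v ≠ 0 := fun h0 => by
    have h1 : v = -(((t / 2 : ℝ) : ℂ) • S v) := eq_neg_of_add_eq_zero_left h0
    have h2 : ‖v‖ ≤ |t| / 2 * (‖S‖ * ‖v‖) := by
      conv_lhs => rw [h1]
      rw [norm_neg, norm_smul, Complex.norm_real, Real.norm_eq_abs, abs_div, abs_two]
      gcongr
      exact S.le_opNorm v
    have := norm_pos_iff.2 hv
    nlinarith
  have h1 : ⟪R ((state ρ₀ θ).op (R v)), v⟫_ℂ = ⟪(state ρ₀ θ).op (R v), R v⟫_ℂ :=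
    ContinuousLinearMap.isSelfAdjoint_iff_isSymmetric.1 hRs _ _
  have h2 : 0 < (⟪(state ρ₀ θ).op (R v), R v⟫_ℂ).re := θ.2 (R v) hRv
  simp only [smul_apply, ContinuousLinearMap.comp_apply, inner_smul_left, Complex.conj_ofReal,
    Complex.re_ofReal_mul, h1]
  positivity

variable {Ω : Type*} [MeasurableSpace Ω]

theorem prob_add_smul (ρ₀ : DensityOperator H) (M : POVM H Ω) (B : Set Ω) (θ φ : Xi H) (c : ℝ) :
    prob ρ₀ M B (θ + c • φ) = prob ρ₀ M B θ + c * (trace (φ.op ∘L M.eff B)).re := by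
  rw [prob, prob, Xi.op_add, Xi.op_smul, ← add_assoc, ContinuousLinearMap.add_comp,
    ContinuousLinearMap.smul_comp, trace_add ((ρ₀.traceClass.add θ.isTraceClass).comp_clm _)
    ((φ.isTraceClass.comp_clm _).smul _), Complex.add_re, re_trace_smul]

/-- The derivative of the outcome probabilities in the direction `(ρS + Sρ)/2`. -/
theorem fderiv_prob_symmProd {ρ₀ : DensityOperator H} {θ : Theta ρ₀} {M : POVM H Ω} {B : Set Ω}
    {S : H →L[ℂ] H} (hS : IsSelfAdjoint S) (hS0 : trace ((state ρ₀ θ).op ∘L S) = 0)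
    {D : Xi H →L[ℝ] ℝ} (hD : HasFDerivWithinAt (prob ρ₀ M B) D (Theta ρ₀) θ.1) :
    D ((state ρ₀ θ).symmProd S hS hS0)
      = (trace (((state ρ₀ θ).symmProd S hS hS0).op ∘L M.eff B)).re := by
  set φ := (state ρ₀ θ).symmProd S hS hS0
  set ψ := (state ρ₀ θ).secondOrder S hS
  obtain ⟨n, hn⟩ : ∃ n, n = (trace (S ∘L (state ρ₀ θ).op ∘L S)).re / 4 := ⟨_, rfl⟩
  have hden : HasDerivAt (fun t : ℝ => 1 + t ^ 2 * n) 0 0 := by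
    simpa using (((hasDerivAt_id (0 : ℝ)).fun_pow 2).mul_const n).const_add 1
  have hu : HasDerivAt (fun t : ℝ => t / (1 + t ^ 2 * n)) 1 0 := by
    simpa using (hasDerivAt_id (0 : ℝ)).fun_div hden (by simp)
  have hw : HasDerivAt (fun t : ℝ => t ^ 2 / (1 + t ^ 2 * n)) 0 0 := by
    simpa using ((hasDerivAt_id (0 : ℝ)).fun_pow 2).fun_div hden (by simp)
  -- The coefficient of `φ` has derivative `1` at `0` and that of the correction `ψ` has derivative
  -- `0`, so only `φ` survives to first order.
  refine hasFDerivWithinAt_apply_eq_of_curve hD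
    (γ := fun t => θ.1 + (t / (1 + t ^ 2 * n)) • φ + (t ^ 2 / (1 + t ^ 2 * n)) • ψ)
    (q := fun t => prob ρ₀ M B θ.1 + (t / (1 + t ^ 2 * n)) * (trace (φ.op ∘L M.eff B)).re
      + (t ^ 2 / (1 + t ^ 2 * n)) * (trace (ψ.op ∘L M.eff B)).re) (by simp) ?_ ?_ ?_ ?_
  · simpa using ((hu.smul_const φ).const_add θ.1).fun_add (hw.smul_const ψ)
  · refine nhdsWithin_le_nhds ?_
    have h1 : ∀ᶠ t in 𝓝 (0 : ℝ), 0 < 1 + t ^ 2 * n :=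
      continuousAt_const.eventually_lt hden.continuousAt (by simp)
    have h2 : ∀ᶠ t in 𝓝 (0 : ℝ), |t| * ‖S‖ < 1 := by
      have : ContinuousAt (fun t : ℝ => |t| * ‖S‖) 0 := by fun_prop
      exact this.eventually_lt continuousAt_const (by simp)
    filter_upwards [h1, h2] with t ht1 ht2
    exact curve_mem_Theta ρ₀ θ hS hS0 hn ht1 ht2
  · simpa using ((hu.mul_const _).const_add _).fun_add (hw.mul_const _)
  · filter_upwards with t
    rw [prob_add_smul, prob_add_smul]

end Score

/-! ### The information inequality for the outcome distribution. -/

section Outcomes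

variable {H : Type*} [NormedAddCommGroup H] [InnerProductSpace ℂ H] [CompleteSpace H]
variable {Ω : Type*} [MeasurableSpace Ω]

instance (M : POVM H Ω) (ρ : DensityOperator H) : IsFiniteMeasure (M.law ρ) :=
  ⟨by rw [M.law_apply ρ MeasurableSet.univ]; exact ENNReal.ofReal_lt_top⟩

theorem POVM.law_real_apply (M : POVM H Ω) (ρ : DensityOperator H) {B : Set Ω}
    (hB : MeasurableSet B) : (M.law ρ).real B = (trace (ρ.op ∘L M.eff B)).re := by
  rw [Measure.real, M.law_apply ρ hB,
    ENNReal.toReal_ofReal (re_trace_comp_nonneg ρ.pos ρ.traceClass (M.pos _ hB))]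

theorem POVM.re_trace_union (M : POVM H Ω) {T : H →L[ℂ] H} (ht : IsTraceClass T) {B C : Set Ω}
    (hB : MeasurableSet B) (hC : MeasurableSet C) (hd : Disjoint B C) :
    (trace (T ∘L M.eff (B ∪ C))).re
      = (trace (T ∘L M.eff B)).re + (trace (T ∘L M.eff C)).re := by
  -- Countable additivity is applied to `B, C, ∅, ∅, …`.
  let E : ℕ → Set Ω := fun n => n.casesOn B fun k => k.casesOn C fun _ => ∅
  have hE : ⋃ n, E n = B ∪ C := by
    ext x
    simp only [Set.mem_iUnion, Set.mem_union]
    constructor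
    · rintro ⟨_ | _ | n, hx⟩
      exacts [Or.inl hx, Or.inr hx, hx.elim]
    · rintro (hx | hx)
      exacts [⟨0, hx⟩, ⟨1, hx⟩]
  have h1 := M.hasSum_trace ht E (by rintro (_ | _ | n); exacts [hB, hC, MeasurableSet.empty]) (by
    rintro (_ | _ | m) (_ | _ | n) hmn
    all_goals first | exact absurd rfl hmn | simp [Function.onFun, E, hd, hd.symm])
  have h2 := hasSum_sum_of_ne_finset_zero (f := fun n => (trace (T ∘L M.eff (E n))).re)
    (s := Finset.range 2) (L := .unconditional ℕ) (by
      rintro (_ | _ | n) hn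
      · simp at hn
      · simp at hn
      · simp [E, M.empty, trace])
  rw [hE] at h1
  simpa [Finset.sum_range_succ, E] using h1.unique h2

theorem POVM.sum_re_trace_fiber (M : POVM H Ω) {T : H →L[ℂ] H} (ht : IsTraceClass T)
    (s : SimpleFunc Ω ℝ) :
    ∑ c ∈ s.range, (trace (T ∘L M.eff (s ⁻¹' {c}))).re = (trace T).re := by
  have key : ∀ t : Finset ℝ, ∑ c ∈ t, (trace (T ∘L M.eff (s ⁻¹' {c}))).re
      = (trace (T ∘L M.eff (s ⁻¹' t))).re := fun t => by
    induction t using Finset.induction_on with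
    | empty => simp [M.empty, trace]
    | insert c t hc ih =>
      rw [Finset.sum_insert hc, ih, Finset.coe_insert, Set.insert_eq, Set.preimage_union,
        M.re_trace_union ht (s.measurableSet_preimage _) (s.measurableSet_preimage _)]
      exact Disjoint.preimage _ (by simpa using hc)
  rw [key, SimpleFunc.coe_range, Set.preimage_range, M.univ, ContinuousLinearMap.comp_id]

theorem sum_setIntegral_fiber {μ : Measure Ω} {h : Ω → ℝ} (hh : Integrable h μ)
    (s : SimpleFunc Ω ℝ) : ∑ c ∈ s.range, ∫ x in s ⁻¹' {c}, h x ∂μ = ∫ x, h x ∂μ := by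
  rw [← integral_biUnion_finset s.range (fun c _ => s.measurableSet_fiber c)
    (fun c _ d _ hcd => Disjoint.preimage _ (by simpa using hcd)) fun c _ => hh.integrableOn]
  have : ⋃ c ∈ s.range, s ⁻¹' {c} = Set.univ :=
    Set.eq_univ_of_forall fun x => Set.mem_biUnion (s.mem_range_self x) rfl
  rw [this, setIntegral_univ]

/-- Both sides split over the fibres of `s`, on each of which `s` is a constant `c`. There the
inequality is `Tr[(S - c) ρ (S - c) M(s = c)] ≥ 0`, expanded. -/
theorem two_mul_integral_sub_le_of_simpleFunc {M : POVM H Ω} {ρ : DensityOperator H}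
    {S : H →L[ℂ] H} (hS : IsSelfAdjoint S) {g : Ω → ℝ} (hg2 : MemLp g 2 (M.law ρ))
    (hg : ∀ B, MeasurableSet B → 2 * ∫ x in B, g x ∂(M.law ρ)
      = (trace ((ρ.op ∘L S + S ∘L ρ.op) ∘L M.eff B)).re) (s : SimpleFunc Ω ℝ) :
    2 * ∫ x, s x * g x ∂(M.law ρ) - ∫ x, s x * s x ∂(M.law ρ)
      ≤ (trace (S ∘L ρ.op ∘L S)).re := by
  have hs2 : MemLp s 2 (M.law ρ) := s.memLp_of_isFiniteMeasure 2 _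
  have hsg : Integrable (fun x => s x * g x) (M.law ρ) := hs2.integrable_mul hg2
  have hss : Integrable (fun x => s x * s x) (M.law ρ) := hs2.integrable_mul hs2
  have hgi : Integrable g (M.law ρ) := hg2.integrable (by norm_num)
  rw [← integral_const_mul, ← integral_sub (hsg.const_mul 2) hss,
    ← sum_setIntegral_fiber (h := fun x => 2 * (s x * g x) - s x * s x) ((hsg.const_mul 2).sub hss) s,
    ← M.sum_re_trace_fiber ((ρ.traceClass.comp_clm S).clm_comp S) s]
  refine Finset.sum_le_sum fun c _ => ?_
  have hB := s.measurableSet_fiber c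
  have h1 : ∫ x in s ⁻¹' {c}, (2 * (s x * g x) - s x * s x) ∂(M.law ρ)
      = c * (2 * ∫ x in s ⁻¹' {c}, g x ∂(M.law ρ)) - c ^ 2 * (M.law ρ).real (s ⁻¹' {c}) := by
    rw [setIntegral_congr_fun (g := fun x => c * (2 * g x) - c ^ 2) hB fun x hx => by
      have hx : s x = c := hx
      simp only [hx]; ring]
    rw [integral_sub ((hgi.integrableOn.const_mul 2).const_mul c) (integrable_const _),
      integral_const_mul, integral_const_mul, setIntegral_const, smul_eq_mul]
    ring
  have hsa : IsSelfAdjoint (S - (c : ℂ) • ContinuousLinearMap.id ℂ H) :=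
    hS.sub (isSelfAdjoint_real_smul c (IsSelfAdjoint.one (H →L[ℂ] H)))
  have h2 := re_trace_comp_nonneg (isPositive_conj_of_isSelfAdjoint ρ.pos hsa)
    ((ρ.traceClass.comp_clm _).clm_comp _) (M.pos _ hB)
  rw [ρ.trace_comp_conj, ← hg _ hB, ← M.law_real_apply ρ hB] at h2
  refine h1.trans_le ?_
  linarith

/-- The left side is a continuous function of `f` in `L²`, where simple functions are dense. -/
theorem two_mul_integral_sub_le {M : POVM H Ω} {ρ : DensityOperator H}
    {S : H →L[ℂ] H} (hS : IsSelfAdjoint S) {g : Ω → ℝ} (hg2 : MemLp g 2 (M.law ρ))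
    (hg : ∀ B, MeasurableSet B → 2 * ∫ x in B, g x ∂(M.law ρ)
      = (trace ((ρ.op ∘L S + S ∘L ρ.op) ∘L M.eff B)).re) {f : Ω → ℝ}
    (hf : MemLp f 2 (M.law ρ)) :
    2 * ∫ x, f x * g x ∂(M.law ρ) - ∫ x, f x * f x ∂(M.law ρ)
      ≤ (trace (S ∘L ρ.op ∘L S)).re := by
  have hinner : ∀ {u v : Ω → ℝ} {U V : Lp ℝ 2 (M.law ρ)}, U =ᵐ[M.law ρ] u → V =ᵐ[M.law ρ] v →
      ⟪U, V⟫_ℝ = ∫ x, u x * v x ∂(M.law ρ) := fun {u v U V} hu hv => by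
    rw [L2.inner_def]
    refine integral_congr_ae ?_
    filter_upwards [hu, hv] with x hx hy
    rw [hx, hy, real_inner_eq_re_inner ℝ, RCLike.inner_apply]
    simp [mul_comm]
  have key : ∀ F : Lp ℝ 2 (M.law ρ),
      2 * ⟪F, hg2.toLp g⟫_ℝ - ⟪F, F⟫_ℝ ≤ (trace (S ∘L ρ.op ∘L S)).re := by
    refine isClosed_property (Lp.simpleFunc.denseRange (by norm_num))
      (isClosed_le (by fun_prop) continuous_const) fun s => ?_
    have hs := (Lp.simpleFunc.toSimpleFunc_eq_toFun s).symm
    rw [hinner hs hg2.coeFn_toLp, hinner hs hs]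
    exact two_mul_integral_sub_le_of_simpleFunc hS hg2 hg _
  have := key (hf.toLp f)
  rwa [hinner hf.coeFn_toLp hg2.coeFn_toLp, hinner hf.coeFn_toLp hf.coeFn_toLp] at this

end Outcomes

/-! ### The Moore–Penrose inverse without completeness. -/

section MoorePenrose

/-- In an incomplete space `(ker J)ᗮ` need not lie in the range of `J`; the existence of `K`
supplies this. The residual `u = G - JKG` satisfies `JKu = 0`, and then `⟨Ju, y⟩ = ⟨u, JKJy⟩ = ⟨JKu,
Jy⟩ = 0`, so `u` is in `ker J`. It is orthogonal to `G` by hypothesis and to `JKG` by symmetry of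
`J`, hence to itself. -/
theorem IsMoorePenroseInverse.apply_apply_of_mem_ker_orthogonal {E : Type*}
    [NormedAddCommGroup E] [InnerProductSpace ℝ E] {J K : E →ₗ[ℝ] E}
    (h : IsMoorePenroseInverse J K) (hJ : J.IsSymmetric) {G : E}
    (hG : G ∈ (LinearMap.ker J)ᗮ) : J (K G) = G := by
  set u := G - J (K G) with hu
  have h1 : ∀ x, J (K (J x)) = J x := fun x => LinearMap.congr_fun h.mul_mul_left x
  have h2 : J (K u) = 0 := by rw [hu, map_sub, map_sub, h1, sub_self]
  have h3 : J u = 0 := by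
    refine ext_inner_right ℝ fun y => ?_
    rw [hJ u y, inner_zero_left, ← h1 y]
    have h4 : ⟪J (K u), J y⟫_ℝ = ⟪u, J (K (J y))⟫_ℝ := h.symm_left u (J y)
    rw [← h4, h2, inner_zero_left]
  have h5 : ⟪u, u⟫_ℝ = 0 := by
    conv_lhs => rw [hu, inner_sub_left, hJ, h3, inner_zero_right, sub_zero]
    exact (real_inner_comm _ _).trans ((Submodule.mem_orthogonal _ _).1 hG u h3)
  exact (sub_eq_zero.1 (inner_self_eq_zero.1 h5)).symm

end MoorePenrose

/-! ### The Cramér–Rao type bound. -/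

section CramerRao

variable {H : Type*} [NormedAddCommGroup H] [InnerProductSpace ℂ H] [CompleteSpace H]
variable {Ω : Type*} [MeasurableSpace Ω]

theorem IsFisherOperator.isSymmetric {ρ₀ : DensityOperator H} {M : POVM H Ω} {θ : Theta ρ₀}
    {J : Xi H →ₗ[ℝ] Xi H} (hJ : IsFisherOperator ρ₀ M θ J) : J.IsSymmetric := by
  obtain ⟨κ, -, -, hκ⟩ := hJ
  intro φ χ
  rw [real_inner_comm, hκ, hκ]
  simp only [mul_comm]

/-- Directions in `Ξ` are traceless, so `G` may be replaced by `S`; cyclicity turns both halves of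
`Tr[S(ρS + Sρ)]/2` into `Tr[ρS²]/2`. -/
theorem inner_symmProd (ρ : DensityOperator H) (G : Xi H) (d : ℝ) {S : H →L[ℂ] H}
    (hS : IsSelfAdjoint S) (hS0 : trace (ρ.op ∘L S) = 0)
    (hG : S = G.op + (d : ℂ) • ContinuousLinearMap.id ℂ H) :
    ⟪G, ρ.symmProd S hS hS0⟫_ℝ = (trace (ρ.op ∘L S ∘L S)).re := by
  set φ := ρ.symmProd S hS hS0 with hφ
  have hop : φ.op = ((1 / 2 : ℝ) : ℂ) • (ρ.op ∘L S + S ∘L ρ.op) := rfl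
  have e : G.op ∘L φ.op = S ∘L φ.op + ((-d : ℝ) : ℂ) • φ.op := by
    rw [hG]; ext v; simp
  have h1 : trace (S ∘L ρ.op ∘L S) = trace (ρ.op ∘L S ∘L S) :=
    trace_comp_comm (ρ.traceClass.comp_clm S) S
  have h2 : trace (S ∘L S ∘L ρ.op) = trace (ρ.op ∘L S ∘L S) :=
    trace_comp_comm ρ.traceClass (S ∘L S)
  rw [Xi.inner_def, e, trace_add (φ.isTraceClass.clm_comp S) (φ.isTraceClass.smul _), trace_smul,
    φ.trace_eq_zero, mul_zero, add_zero, hop, ContinuousLinearMap.comp_smul, re_trace_smul,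
    ContinuousLinearMap.comp_add, trace_add ((ρ.traceClass.comp_clm S).clm_comp S)
    ((ρ.traceClass.clm_comp S).clm_comp S), h1, h2, Complex.add_re]
  ring

/-- The Cramér-Rao type bound for the error of a measurement of an observable. -/
theorem variance_le_inner_of_isFisherOperator {ρ₀ : DensityOperator H} {θ : Theta ρ₀}
    {M : POVM H Ω} {J K : Xi H →ₗ[ℝ] Xi H} (hJ : IsFisherOperator ρ₀ M θ J)
    (hK : IsMoorePenroseInverse J K) {A : H →ₗ.[ℂ] H} (hA : A ∈ observables (state ρ₀ θ).op)
    {G : Xi H} (hG : HasExpectationGradient ρ₀ A θ G) (hGk : G ∈ (LinearMap.ker J)ᗮ) :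
    HasFiniteExpectation (state ρ₀ θ).op (square A) ∧
      variance (state ρ₀ θ).op A ≤ ⟪G, K G⟫_ℝ := by
  obtain ⟨c, hc⟩ := exists_eq_add_smul_of_hasExpectationGradient hA hG
  have htop := domain_eq_top_of_eq_clm hA.1 (G.op + (c : ℂ) • ContinuousLinearMap.id ℂ H) hc
  have hsymm := hJ.isSymmetric
  have hJK := hK.apply_apply_of_mem_ker_orthogonal hsymm hGk
  obtain ⟨κ, hlog, hκ2, hκ⟩ := hJ
  set ρ := state ρ₀ θ with hρ
  -- The shift that gives `S` mean zero; `A` then equals `S + (c - d)`.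
  obtain ⟨d, hd⟩ : ∃ d, d = -(trace (ρ.op ∘L G.op)).re := ⟨_, rfl⟩
  obtain ⟨S, hSdef⟩ : ∃ S, S = G.op + (d : ℂ) • ContinuousLinearMap.id ℂ H := ⟨_, rfl⟩
  have hS : IsSelfAdjoint S := by
    rw [hSdef]
    exact G.isSelfAdjoint.add (isSelfAdjoint_real_smul d (IsSelfAdjoint.one (H →L[ℂ] H)))
  have hS0 : trace (ρ.op ∘L S) = 0 := by
    have : ρ.op ∘L S = ρ.op ∘L G.op + (d : ℂ) • ρ.op := by rw [hSdef]; ext v; simp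
    rw [this, trace_add (ρ.traceClass.comp_clm _) (ρ.traceClass.smul _), trace_smul,
      ρ.trace_eq_one, ρ.trace_comp_eq_ofReal_re G.isSelfAdjoint, hd]
    push_cast
    ring
  obtain ⟨hfin, hvar⟩ := variance_eq (ρ := ρ) htop hS0 (c - d) fun x => by
    rw [hc, hSdef]
    simp only [add_apply, smul_apply, ContinuousLinearMap.id_apply]
    push_cast
    module
  refine ⟨hfin, ?_⟩
  -- Domination by `‖φ‖ ‖κ‖`. Measurability comes from the integrability of `(κ, φ)`, as `κ` itself
  -- is not assumed measurable.
  have hmem : ∀ φ, MemLp (fun x => ⟪κ x, φ⟫_ℝ) 2 (M.law ρ) := fun φ => by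
    refine (hκ2.const_mul ‖φ‖).mono (hlog.integrable φ).aestronglyMeasurable
      (Eventually.of_forall fun x => ?_)
    rw [norm_mul, norm_norm, norm_norm, mul_comm]
    exact norm_inner_le_norm _ _
  set φ := ρ.symmProd S hS hS0 with hφ
  have hscore : ∀ B, MeasurableSet B → 2 * ∫ x in B, ⟪κ x, φ⟫_ℝ ∂(M.law ρ)
      = (trace ((ρ.op ∘L S + S ∘L ρ.op) ∘L M.eff B)).re := fun B hB => by
    obtain ⟨D, hD, hDφ⟩ := hlog.hasFDeriv B hB
    have h1 : (trace (φ.op ∘L M.eff B)).re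
        = 1 / 2 * (trace ((ρ.op ∘L S + S ∘L ρ.op) ∘L M.eff B)).re := by
      rw [← re_trace_smul, ← ContinuousLinearMap.smul_comp]
      rfl
    rw [← hDφ, hφ, fderiv_prob_symmProd hS hS0 hD, ← hφ, h1]
    ring
  -- The choice `f = (κ, KG)` turns the integrals into `(KG, Jφ) = (JKG, φ) = (G, φ)` and `(KG, JKG)
  -- = (KG, G)`. Both `(G, φ)` and `Tr[SρS]` are the variance.
  have hmain := two_mul_integral_sub_le hS (hmem φ) hscore (hmem (K G))
  have h1 : trace (S ∘L ρ.op ∘L S) = trace (ρ.op ∘L S ∘L S) :=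
    trace_comp_comm (ρ.traceClass.comp_clm S) S
  rw [← hκ, ← hκ, hJK, h1, ← hvar, ← hsymm, hJK, hφ, inner_symmProd ρ G d hS hS0 hSdef, ← hvar,
    real_inner_comm] at hmain
  linarith

end CramerRao

end QuantumEstimation

theorem mainTheorem9 {H : Type*} [NormedAddCommGroup H] [InnerProductSpace ℂ H]
    [CompleteSpace H] [TopologicalSpace.SeparableSpace H]
    {Ω : Type*} [MeasurableSpace Ω]
    (ρ₀ : DensityOperator H) (θ : Theta ρ₀) (M : POVM H Ω)
    (hJ : ∃ J : Xi H →ₗ[ℝ] Xi H, IsFisherOperator ρ₀ M θ J)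
    (hJp : ∃ K : Xi H →ₗ[ℝ] Xi H, IsMoorePenroseInverse (fisherOperator ρ₀ M θ) K)
    (A : H →ₗ.[ℂ] H) (hA : A ∈ observables (state ρ₀ θ).op) :
    (∀ G : Xi H, HasExpectationGradient ρ₀ A θ G →
      G ∈ (LinearMap.ker (fisherOperator ρ₀ M θ))ᗮ →
        HasFiniteExpectation (state ρ₀ θ).op (square A) ∧
        variance (state ρ₀ θ).op A ≤ ⟪G, moorePenrose (fisherOperator ρ₀ M θ) G⟫_ℝ) ∧
    0 ≤ measurementError ρ₀ M θ A := by
  -- The existence hypotheses exclude the default value zero of the chosen Fisher operator and of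
  -- its inverse.
  have hF : IsFisherOperator ρ₀ M θ (fisherOperator ρ₀ M θ) := by
    rw [fisherOperator, dif_pos hJ]
    exact hJ.choose_spec
  have hK : IsMoorePenroseInverse (fisherOperator ρ₀ M θ)
      (moorePenrose (fisherOperator ρ₀ M θ)) := by
    rw [moorePenrose, dif_pos hJp]
    exact hJp.choose_spec
  have hmain := fun (G : Xi H) (hG : HasExpectationGradient ρ₀ A θ G)
    (hGk : G ∈ (LinearMap.ker (fisherOperator ρ₀ M θ))ᗮ) =>
      variance_le_inner_of_isFisherOperator hF hK hA hG hGk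
  refine ⟨hmain, ?_⟩
  rw [measurementError]
  split_ifs with h
  -- The bound holds for every admissible gradient, so no uniqueness of the chosen one is needed.
  · exact EReal.coe_nonneg.2 (sub_nonneg.2 (hmain _ h.choose_spec.1 h.choose_spec.2).2)
  · exact le_top
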